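/- Let $N_d \ge 0$ and $N_p\ge 1$ be integers, let $\mathbf h:\mathbb R^{N_p}\to\mathbb C^{N_d}$ be differentiable at $\boldsymbol\theta$, with complex gradient $\frac{\partial\mathbf h}{\partial\boldsymbol\theta}=\big(\frac{\partial\mathbf h}{\partial\theta_1},\dots,\frac{\partial\mathbf h}{\partial\theta_{N_p}}\big)\in\mathbb C^{N_d\times N_p}$, and let $\mathcal V_{\boldsymbol\theta}=\{\frac{\partial\mathbf h}{\partial\boldsymbol\theta}\mathbf x:\mathbf x\in\mathbb R^{N_p}\}$ be the variation space, assumed to satisfy $\dim_{\mathbb R}\mathcal V_{\boldsymbol\theta}=N_p$. Let $\sigma>0$ and $P>0$. For $N_m\ge 0$ and an observation matrix $\mathbf M\in\mathbb C^{N_d\times N_m}$, let $\mathbf I(\boldsymbol\theta,\mathbf M)\in\mathbb R^{N_p\times N_p}$ be the Fisher information matrix, at $\boldsymbol\theta$, of the observation $\mathbf y=\mathbf M^H\mathbf h(\boldsymbol\theta)+\mathbf n$, $\mathbf n\sim\mathcal{CN}(\mathbf 0,\sigma^2\mathbf{Id}_{N_m})$ (circular complex Gaussian), and let $$\mathrm{CRB}(\boldsymbol\theta,\mathbf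 M)=\mathrm{Tr}\Big[\frac{\partial\mathbf h}{\partial\boldsymbol\theta}\,\mathbf I(\boldsymbol\theta,\mathbf M)^{-1}\,\frac{\partial\mathbf h}{\partial\boldsymbol\theta}^{H}\Big]$$ be the Cramér–Rao bound, with the value $+\infty$ if $\mathbf I(\boldsymbol\theta,\mathbf M)$ is singular. Let $\epsilon=N_p \bmod 2$. By a decomposition of $\mathcal V_{\boldsymbol\theta}$ we mean vectors $\mathbf v_1,\dots,\mathbf v_{\lceil N_p/2\rceil}$ and $\mathbf w_1,\dots,\mathbf w_{\lfloor N_p/2\rfloor}$ in $\mathbb C^{N_d}$ whose real linear span is $\mathcal V_{\boldsymbol\theta}$, and scalars $c_1,\dots,c_{\lfloor N_p/2\rfloor}\in[0,1]$, such that $\mathbf v_m^H\mathbf v_n=\delta_{mn}$, $\mathbf w_m^H\mathbf w_n=\delta_{mn}$ and $\mathbf v_m^H\mathbf w_n=-\delta_{mn}\,\mathrm j\,c_n$ for all $m,n$ in the respective index ranges. The scalars $c_k$ measure the lack of $\mathbb C$-orthogonality of the decomposition. Then: 1. A decomposition of $\mathcal V_{\boldsymbol\theta}$ exists. 2. For every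 decomposition of $\mathcal V_{\boldsymbol\theta}$, the minimum of $\mathrm{CRB}(\boldsymbol\theta,\mathbf M)$ over all observation matrices $\mathbf M$, with any number of columns, such that $\|\mathbf M\|_F^2=P$ exists and equals $$\mathrm{CRB}_{\min}(\boldsymbol\theta)=\frac{2\sigma^2}{P}\left(\sum_{k=1}^{\lfloor N_p/2\rfloor}\frac1{\sqrt{1+c_k}}+\frac{\epsilon}{2}\right)^2 .$$ It is attained by the following matrix with $\lceil N_p/2\rceil$ columns, which satisfies $\|\mathbf M\|_F^2=P$: with $C=2\sum_{l=1}^{\lfloor N_p/2\rfloor}\frac1{\sqrt{1+c_l}}+\epsilon$, $$\mathbf M=\sqrt{\tfrac PC}\left(\frac{\mathbf v_1+\mathrm j\mathbf w_1}{(1+c_1)^{3/4}},\dots,\frac{\mathbf v_{\lfloor N_p/2\rfloor}+\mathrm j\mathbf w_{\lfloor N_p/2\rfloor}}{(1+c_{\lfloor N_p/2\rfloor})^{3/4}}\right)$$ if $N_p$ is even, and the same matrix with the additional last column $\sqrt{P/C}\,\mathbf v_{\lfloor N_p/2\rfloor+1}$ if $N_p$ is odd. 3. This size is minimal: every observation matrix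 $\mathbf M$ with $\mathrm{CRB}(\boldsymbol\theta,\mathbf M)<+\infty$ has at least $\lceil N_p/2\rceil$ columns. -/

import Mathlib

noncomputable section

namespace ChannelCRB

/-- The partial derivative `∂h/∂θ_k` of the channel at the parameter value `θ`. -/
def partialDeriv {Nd Np : ℕ} (h : EuclideanSpace ℝ (Fin Np) → EuclideanSpace ℂ (Fin Nd))
    (θ : EuclideanSpace ℝ (Fin Np)) (k : Fin Np) : EuclideanSpace ℂ (Fin Nd) :=
  lineDeriv ℝ h θ (EuclideanSpace.single k 1)

/-- The complex gradient `∂h/∂θ`, whose `k`-th column is `∂h/∂θ_k`. -/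
def gradientMatrix {Nd Np : ℕ} (h : EuclideanSpace ℝ (Fin Np) → EuclideanSpace ℂ (Fin Nd))
    (θ : EuclideanSpace ℝ (Fin Np)) : Matrix (Fin Nd) (Fin Np) ℂ :=
  Matrix.of fun i k => partialDeriv h θ k i

/-- The variation space `{(∂h/∂θ) x : x ∈ ℝ^Np}`, a real subspace of `ℂ^Nd`. -/
def variationSpace {Nd Np : ℕ} (h : EuclideanSpace ℝ (Fin Np) → EuclideanSpace ℂ (Fin Nd))
    (θ : EuclideanSpace ℝ (Fin Np)) : Submodule ℝ (EuclideanSpace ℂ (Fin Nd)) :=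
  LinearMap.range (Fintype.linearCombination ℝ (partialDeriv h θ))

/-- The probability density, at `y ∈ ℂ^Nm`, of the observation `Mᴴ h(θ) + n`, where the
entries of `n` are i.i.d. circular complex Gaussians of variance `σ²`. -/
def likelihood {Nd Np Nm : ℕ} (h : EuclideanSpace ℝ (Fin Np) → EuclideanSpace ℂ (Fin Nd))
    (σ : ℝ) (M : Matrix (Fin Nd) (Fin Nm) ℂ) (θ : EuclideanSpace ℝ (Fin Np))
    (y : Fin Nm → ℂ) : ℝ :=
  ∏ i, (Real.pi * σ ^ 2)⁻¹ *
    Real.exp (-(‖y i - (M.conjTranspose.mulVec (fun d => h θ d)) i‖ ^ 2 / σ ^ 2))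

/-- The score: partial derivative of the log-likelihood with respect to `θ_k`. -/
def score {Nd Np Nm : ℕ} (h : EuclideanSpace ℝ (Fin Np) → EuclideanSpace ℂ (Fin Nd))
    (σ : ℝ) (M : Matrix (Fin Nd) (Fin Nm) ℂ) (θ : EuclideanSpace ℝ (Fin Np))
    (k : Fin Np) (y : Fin Nm → ℂ) : ℝ :=
  lineDeriv ℝ (fun ϑ => Real.log (likelihood h σ M ϑ y)) θ (EuclideanSpace.single k 1)

/-- The Fisher information matrix: expectation of the products of scores under the law of
the observation (integral with respect to Lebesgue measure on `ℂ^Nm`). -/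
def fisherInformation {Nd Np Nm : ℕ}
    (h : EuclideanSpace ℝ (Fin Np) → EuclideanSpace ℂ (Fin Nd))
    (σ : ℝ) (M : Matrix (Fin Nd) (Fin Nm) ℂ) (θ : EuclideanSpace ℝ (Fin Np)) :
    Matrix (Fin Np) (Fin Np) ℝ :=
  Matrix.of fun k l =>
    ∫ y : Fin Nm → ℂ, score h σ M θ k y * score h σ M θ l y * likelihood h σ M θ y

open Classical in
/-- The Cramér–Rao bound `Tr[(∂h/∂θ) I(θ,M)⁻¹ (∂h/∂θ)ᴴ]`, equal to `+∞` when the Fisher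
information matrix is singular (non-identifiable parameters). The trace is a real number,
the matrix inside being Hermitian. -/
def crb {Nd Np Nm : ℕ} (h : EuclideanSpace ℝ (Fin Np) → EuclideanSpace ℂ (Fin Nd))
    (σ : ℝ) (θ : EuclideanSpace ℝ (Fin Np)) (M : Matrix (Fin Nd) (Fin Nm) ℂ) : EReal :=
  if IsUnit (fisherInformation h σ M θ).det then
    (((gradientMatrix h θ * ((fisherInformation h σ M θ)⁻¹).map (fun x : ℝ => (x : ℂ)) *
      (gradientMatrix h θ).conjTranspose).trace.re : ℝ) : EReal)
  else ⊤

/-- The squared Frobenius norm `‖M‖_F²`. -/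
def frobeniusSq {m n : ℕ} (M : Matrix (Fin m) (Fin n) ℂ) : ℝ :=
  ∑ i, ∑ j, ‖M i j‖ ^ 2

/-- The vectors `v_1, …, v_⌈Np/2⌉`, `w_1, …, w_⌊Np/2⌋` and scalars `c_1, …, c_⌊Np/2⌋ ∈ [0,1]`
form a decomposition of the real subspace `V` into mutually `ℂ`-orthogonal planes
`span_ℝ {v_k, w_k}` (and a line spanned by the last `v` when `Np` is odd):
`v_mᴴ v_n = δ_mn`, `w_mᴴ w_n = δ_mn`, `v_mᴴ w_n = -δ_mn j c_m`. -/
structure IsDecomposition {Nd : ℕ} (Np : ℕ) (V : Submodule ℝ (EuclideanSpace ℂ (Fin Nd)))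
    (v : Fin ((Np + 1) / 2) → EuclideanSpace ℂ (Fin Nd))
    (w : Fin (Np / 2) → EuclideanSpace ℂ (Fin Nd))
    (c : Fin (Np / 2) → ℝ) : Prop where
  span_eq : Submodule.span ℝ (Set.range v ∪ Set.range w) = V
  inner_v_v : ∀ m n, inner ℂ (v m) (v n) = if m = n then (1 : ℂ) else 0
  inner_w_w : ∀ m n, inner ℂ (w m) (w n) = if m = n then (1 : ℂ) else 0
  inner_v_w : ∀ m n, inner ℂ (v m) (w n) =
    if (m : ℕ) = (n : ℕ) then -(Complex.I * (c n : ℂ)) else 0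
  c_nonneg : ∀ k, 0 ≤ c k
  c_le_one : ∀ k, c k ≤ 1

/-- The minimal value `(2σ²/P) (∑_k 1/√(1+c_k) + ε/2)²`, where `ε = Np mod 2`. -/
def crbMin (Np : ℕ) (σ P : ℝ) (c : Fin (Np / 2) → ℝ) : ℝ :=
  2 * σ ^ 2 / P * ((∑ k, 1 / Real.sqrt (1 + c k)) + ((Np % 2 : ℕ) : ℝ) / 2) ^ 2

/-- The normalization constant `C = 2 ∑_k 1/√(1+c_k) + ε`, where `ε = Np mod 2`. -/
def normConst (Np : ℕ) (c : Fin (Np / 2) → ℝ) : ℝ :=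
  2 * (∑ k, 1 / Real.sqrt (1 + c k)) + ((Np % 2 : ℕ) : ℝ)

/-- The observation matrix with `⌈Np/2⌉` columns, equal to `√(P/C)` times
`(v_k + j w_k) / (1 + c_k)^(3/4)` for `k ≤ ⌊Np/2⌋`, and to `√(P/C)` times the last `v` for the
remaining column when `Np` is odd. -/
def optimalMatrix {Nd : ℕ} (Np : ℕ) (P : ℝ)
    (v : Fin ((Np + 1) / 2) → EuclideanSpace ℂ (Fin Nd))
    (w : Fin (Np / 2) → EuclideanSpace ℂ (Fin Nd))
    (c : Fin (Np / 2) → ℝ) : Matrix (Fin Nd) (Fin ((Np + 1) / 2)) ℂ :=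
  Matrix.of fun i k =>
    (Real.sqrt (P / normConst Np c) : ℂ) *
      (if hk : (k : ℕ) < Np / 2 then
        (v k i + Complex.I * w ⟨k, hk⟩ i) / (((1 + c ⟨k, hk⟩) ^ (3 / 4 : ℝ) : ℝ) : ℂ)
      else v k i)

end ChannelCRB

end

/-! For Gaussian noise the Fisher matrix is `2 / σ ^ 2` times the real Gram matrix of the observed
derivatives. In an `ℝ`-orthonormal basis `e` of the variation space the parametrization cancels, and
the bound is `σ ^ 2 / 2` times the trace of `A⁻¹`, with `A` the real Gram matrix of the observed `e
i` (`crb_eq_of_orthonormal`).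

A decomposition supplies such a basis. It exists because multiplication by `j`, compressed to the
variation space, is skew-symmetric and so splits the space into invariant planes. Planes orthogonal
over `ℝ` are then orthogonal over `ℂ` (`exists_plane`).

The lower bound combines two inequalities. Positivity gives `(A⁻¹) i i ≥ 2 s i - s i ^ 2 * A i i`
for every choice of `s` (`trace_inv_ge`). The weighted Bessel inequality, with weights `t i = 1 /
√(1 + c)`, is summed over the columns of `M` and turns the power budget into `∑ t i ^ 2 * A i i ≤
P`. With `s` proportional to `t` this yields `(∑ t i) ^ 2 / P`. The matrix of the theorem sends
`v_k` and `w_k` to the real and imaginary axes of the `k`-th complex coordinate, so `A` is diagonal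
with `A i i = 1 / s i`, and equality holds.

A finite bound makes the `Np` observed derivatives `ℝ`-independent in a space of real dimension `2 *
Nm`, whence the column count. -/

noncomputable section

namespace ChannelCRB

/-! ### Second moments of the circular complex Gaussian density -/

section

open MeasureTheory

/-- The density of the circular complex Gaussian law of variance `σ²`. -/
def circularDensity (σ : ℝ) (z : ℂ) : ℝ :=
  (Real.pi * σ ^ 2)⁻¹ * Real.exp (-(‖z‖ ^ 2 / σ ^ 2))

theorem integral_comp_isometryEquiv (e : ℂ ≃ₗᵢ[ℝ] ℂ) (f : ℂ → ℝ) :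
    ∫ z, f (e z) = ∫ z, f z :=
  e.measurePreserving.integral_comp e.toHomeomorph.measurableEmbedding f

theorem circularDensity_isometryEquiv (σ : ℝ) (e : ℂ ≃ₗᵢ[ℝ] ℂ) (z : ℂ) :
    circularDensity σ (e z) = circularDensity σ z := by
  simp [circularDensity]

theorem circularDensity_nonneg (σ : ℝ) (z : ℂ) : 0 ≤ circularDensity σ z := by
  unfold circularDensity; positivity

theorem continuous_circularDensity (σ : ℝ) : Continuous (circularDensity σ) := by
  unfold circularDensity; fun_prop

theorem integral_circularDensity {σ : ℝ} (hσ : 0 < σ) : ∫ z, circularDensity σ z = 1 := by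
  have h := Complex.integral_exp_neg_mul_rpow (p := 2) (b := (σ ^ 2)⁻¹) (by norm_num) (by positivity)
  have h2 : ((σ ^ 2)⁻¹ : ℝ) ^ (-2 / 2 : ℝ) = σ ^ 2 := by
    rw [show (-2 / 2 : ℝ) = -1 by norm_num, Real.rpow_neg_one, inv_inv]
  rw [h2] at h
  norm_num at h
  simp only [circularDensity]
  rw [integral_const_mul]
  have : ∀ z : ℂ, Real.exp (-(‖z‖ ^ 2 / σ ^ 2)) = Real.exp (-((σ ^ 2)⁻¹ * ‖z‖ ^ 2)) := by
    intro z; congr 2; ring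
  simp_rw [this, h]
  field_simp

theorem integral_norm_sq_mul_circularDensity {σ : ℝ} (hσ : 0 < σ) :
    ∫ z : ℂ, ‖z‖ ^ 2 * circularDensity σ z = σ ^ 2 := by
  have h := Complex.integral_rpow_mul_exp_neg_mul_rpow (p := 2) (q := 2) (b := (σ ^ 2)⁻¹)
    (by norm_num) (by norm_num) (by positivity)
  have h2 : ((σ ^ 2)⁻¹ : ℝ) ^ (-(2 + 2) / 2 : ℝ) = σ ^ 4 := by
    rw [show (-(2 + 2) / 2 : ℝ) = -(2 : ℕ) by norm_num, Real.rpow_neg (by positivity),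
      Real.rpow_natCast]
    field_simp
  rw [h2, show ((2 + 2) / 2 : ℝ) = 2 by norm_num, Real.Gamma_two] at h
  norm_num at h
  simp only [circularDensity]
  have : ∀ z : ℂ, ‖z‖ ^ 2 * ((Real.pi * σ ^ 2)⁻¹ * Real.exp (-(‖z‖ ^ 2 / σ ^ 2))) =
      (Real.pi * σ ^ 2)⁻¹ * (‖z‖ ^ 2 * Real.exp (-((σ ^ 2)⁻¹ * ‖z‖ ^ 2))) := by
    intro z
    rw [show -(‖z‖ ^ 2 / σ ^ 2) = -((σ ^ 2)⁻¹ * ‖z‖ ^ 2) by ring]; ring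
  simp_rw [this]
  rw [integral_const_mul, h]
  field_simp

theorem integrable_circularDensity {σ : ℝ} (hσ : 0 < σ) : Integrable (circularDensity σ) := by
  -- A non-integrable function has integral `0` by convention, which contradicts the value `1`.
  by_contra h
  have := integral_circularDensity hσ
  rw [integral_undef h] at this
  norm_num at this

theorem integrable_norm_sq_mul_circularDensity {σ : ℝ} (hσ : 0 < σ) :
    Integrable (fun z : ℂ => ‖z‖ ^ 2 * circularDensity σ z) := by
  by_contra h
  have := integral_norm_sq_mul_circularDensity hσ
  rw [integral_undef h] at this
  have : 0 < σ ^ 2 := by positivity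
  linarith

theorem integrable_inner_mul_inner {σ : ℝ} (hσ : 0 < σ) (a b : ℂ) :
    Integrable (fun z : ℂ => inner ℝ a z * inner ℝ b z * circularDensity σ z) := by
  refine ((integrable_norm_sq_mul_circularDensity hσ).const_mul (‖a‖ * ‖b‖)).mono'
    (Continuous.aestronglyMeasurable ?_) (Filter.Eventually.of_forall fun z => ?_)
  · have := continuous_circularDensity σ
    fun_prop
  · rw [norm_mul, norm_mul, Real.norm_of_nonneg (circularDensity_nonneg σ z), ← mul_assoc]
    refine mul_le_mul_of_nonneg_right ?_ (circularDensity_nonneg σ z)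
    calc _ ≤ (‖a‖ * ‖z‖) * (‖b‖ * ‖z‖) :=
          mul_le_mul (norm_inner_le_norm a z) (norm_inner_le_norm b z) (norm_nonneg _)
            (by positivity)
      _ = _ := by ring

theorem integrable_inner_mul_circularDensity {σ : ℝ} (hσ : 0 < σ) (a : ℂ) :
    Integrable (fun z : ℂ => inner ℝ a z * circularDensity σ z) := by
  refine (((integrable_norm_sq_mul_circularDensity hσ).add
    (integrable_circularDensity hσ)).const_mul ‖a‖).mono'
    (Continuous.aestronglyMeasurable ?_) (Filter.Eventually.of_forall fun z => ?_)
  · have := continuous_circularDensity σ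
    fun_prop
  · have h0 := circularDensity_nonneg σ z
    rw [norm_mul, Real.norm_of_nonneg h0]
    calc _ ≤ ‖a‖ * ‖z‖ * circularDensity σ z :=
          mul_le_mul_of_nonneg_right (norm_inner_le_norm a z) h0
      _ ≤ ‖a‖ * (‖z‖ ^ 2 + 1) * circularDensity σ z := by
          refine mul_le_mul_of_nonneg_right (mul_le_mul_of_nonneg_left ?_ (norm_nonneg a)) h0
          nlinarith [sq_nonneg (‖z‖ - 1)]
      _ = _ := by simp only [Pi.add_apply]; ring

/-- The density is even and the other factor is odd. -/
theorem integral_inner_mul_circularDensity (σ : ℝ) (a : ℂ) :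
    ∫ z : ℂ, inner ℝ a z * circularDensity σ z = 0 := by
  have h := integral_comp_isometryEquiv (LinearIsometryEquiv.neg ℝ)
    (fun z => inner ℝ a z * circularDensity σ z)
  simp only [circularDensity_isometryEquiv] at h
  simp only [LinearIsometryEquiv.coe_neg, inner_neg_right, neg_mul, integral_neg] at h
  linarith

/-- Symmetry reduces everything to the total variance: conjugation kills the mixed moment, and a
quarter turn exchanges the moments of the real and imaginary parts, so each is half of `σ ^ 2`. -/
theorem integral_inner_mul_inner {σ : ℝ} (hσ : 0 < σ) (a b : ℂ) :
    ∫ z : ℂ, inner ℝ a z * inner ℝ b z * circularDensity σ z = σ ^ 2 / 2 * inner ℝ a b := by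
  have ixx : Integrable fun z : ℂ => z.re ^ 2 * circularDensity σ z := by
    refine (integrable_inner_mul_inner hσ 1 1).congr (.of_forall fun z => ?_)
    simp [Complex.inner, sq]
  have iyy : Integrable fun z : ℂ => z.im ^ 2 * circularDensity σ z := by
    refine (integrable_inner_mul_inner hσ Complex.I Complex.I).congr (.of_forall fun z => ?_)
    simp [Complex.inner, sq]
  have ixy : Integrable fun z : ℂ => z.re * z.im * circularDensity σ z := by
    refine (integrable_inner_mul_inner hσ 1 Complex.I).congr (.of_forall fun z => ?_)
    simp [Complex.inner]
  have hc : ∫ z : ℂ, z.re * z.im * circularDensity σ z = 0 := by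
    have hg (z : ℂ) : circularDensity σ (starRingEnd ℂ z) = circularDensity σ z := by
      simp [circularDensity]
    have h := integral_comp_isometryEquiv Complex.conjLIE
      (fun z => z.re * z.im * circularDensity σ z)
    simp only [hg, Complex.conjLIE_apply, Complex.conj_re,
      Complex.conj_im, mul_neg, neg_mul, integral_neg] at h
    linarith
  have hr : ∫ z : ℂ, z.im ^ 2 * circularDensity σ z = ∫ z : ℂ, z.re ^ 2 * circularDensity σ z := by
    have h := integral_comp_isometryEquiv (rotation (Circle.exp (Real.pi / 2)))
      (fun z => z.re ^ 2 * circularDensity σ z)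
    have hI (z : ℂ) : (rotation (Circle.exp (Real.pi / 2)) z).re = -z.im := by
      rw [rotation_apply, Circle.coe_exp]
      push_cast
      rw [Complex.exp_pi_div_two_mul_I]
      simp
    simpa only [circularDensity_isometryEquiv, hI, neg_sq] using h
  have hn : (∫ z : ℂ, z.re ^ 2 * circularDensity σ z) +
      ∫ z : ℂ, z.im ^ 2 * circularDensity σ z = σ ^ 2 := by
    rw [← integral_norm_sq_mul_circularDensity hσ, ← integral_add ixx iyy]
    congr 1; ext z
    rw [Complex.sq_norm, Complex.normSq_apply]; ring
  have expand : ∀ z : ℂ, inner ℝ a z * inner ℝ b z * circularDensity σ z =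
      a.re * b.re * (z.re ^ 2 * circularDensity σ z) +
      a.im * b.im * (z.im ^ 2 * circularDensity σ z) +
      (a.re * b.im + a.im * b.re) * (z.re * z.im * circularDensity σ z) := by
    intro z
    simp only [Complex.inner, Complex.mul_re, Complex.conj_re, Complex.conj_im]
    ring
  simp_rw [expand]
  rw [integral_add (f := fun z : ℂ => a.re * b.re * (z.re ^ 2 * circularDensity σ z) +
      a.im * b.im * (z.im ^ 2 * circularDensity σ z))
      ((ixx.const_mul _).add (iyy.const_mul _)) (ixy.const_mul _),
    integral_add (ixx.const_mul _) (iyy.const_mul _), integral_const_mul, integral_const_mul,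
    integral_const_mul, hc, hr]
  rw [hr] at hn
  simp only [Complex.inner, Complex.mul_re, Complex.conj_re, Complex.conj_im]
  rw [show (∫ z : ℂ, z.re ^ 2 * circularDensity σ z) = σ ^ 2 / 2 by linarith]
  ring

/-- The integral of a product of two coordinate functionals against the product density. -/
theorem integral_coordinate_mul_coordinate {n : ℕ} {σ : ℝ} (hσ : 0 < σ)
    (a b : Fin n → ℂ) (i j : Fin n) :
    Integrable (fun z : Fin n → ℂ =>
      inner ℝ (a i) (z i) * inner ℝ (b j) (z j) * ∏ l, circularDensity σ (z l)) ∧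
    ∫ z : Fin n → ℂ, inner ℝ (a i) (z i) * inner ℝ (b j) (z j) * ∏ l, circularDensity σ (z l) =
      if i = j then σ ^ 2 / 2 * inner ℝ (a i) (b i) else 0 := by
  -- Each linear factor is absorbed into its own coordinate, so that the integrand becomes a product
  -- of one-variable functions and Fubini applies.
  set F : Fin n → ℂ → ℝ := fun l z => (if l = i then inner ℝ (a i) z else 1) *
    (if l = j then inner ℝ (b j) z else 1) * circularDensity σ z with hF
  have hprod : ∀ z : Fin n → ℂ, inner ℝ (a i) (z i) * inner ℝ (b j) (z j) *
      ∏ l, circularDensity σ (z l) = ∏ l, F l (z l) := by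
    intro z
    simp only [hF, Finset.prod_mul_distrib, Finset.prod_ite_eq', Finset.mem_univ, if_true]
  simp_rw [hprod]
  constructor
  · refine Integrable.fintype_prod (f := F) fun l => ?_
    by_cases hi : l = i <;> by_cases hj : l = j
    · simpa only [hF, if_pos hi, if_pos hj] using integrable_inner_mul_inner hσ _ _
    · simpa only [hF, if_pos hi, if_neg hj, mul_one] using
        integrable_inner_mul_circularDensity hσ _
    · simpa only [hF, if_neg hi, if_pos hj, one_mul] using
        integrable_inner_mul_circularDensity hσ _
    · simpa only [hF, if_neg hi, if_neg hj, one_mul] using integrable_circularDensity hσ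
  · rw [integral_fintype_prod_volume_eq_prod]
    split_ifs with hij
    · subst hij
      rw [Finset.prod_eq_single i]
      · simpa only [hF, if_true] using integral_inner_mul_inner hσ _ _
      · intro l _ hl
        simpa [hF, hl] using integral_circularDensity hσ
      · simp
    · refine Finset.prod_eq_zero (Finset.mem_univ i) ?_
      simpa only [hF, hij, if_true, if_false, mul_one] using integral_inner_mul_circularDensity σ _

theorem integral_sum_inner_mul_sum_inner {n : ℕ} {σ : ℝ} (hσ : 0 < σ) (a b : Fin n → ℂ) :
    ∫ z : Fin n → ℂ, (∑ i, inner ℝ (a i) (z i)) * (∑ i, inner ℝ (b i) (z i)) *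
      ∏ l, circularDensity σ (z l) = σ ^ 2 / 2 * ∑ i, inner ℝ (a i) (b i) := by
  simp_rw [Finset.sum_mul_sum, Finset.sum_mul]
  rw [integral_finsetSum _ fun i _ => integrable_finsetSum _ fun j _ =>
    (integral_coordinate_mul_coordinate hσ a b i j).1, Finset.mul_sum]
  refine Finset.sum_congr rfl fun i _ => ?_
  rw [integral_finsetSum _ fun j _ => (integral_coordinate_mul_coordinate hσ a b i j).1]
  simp_rw [(integral_coordinate_mul_coordinate hσ a b i _).2]
  simp

end

/-! ### The Fisher matrix as a Gram matrix -/

section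

open MeasureTheory

/-- The complex linear map `x ↦ Mᴴ x`. -/
def observation {Nd Nm : ℕ} (M : Matrix (Fin Nd) (Fin Nm) ℂ) :
    EuclideanSpace ℂ (Fin Nd) →ₗ[ℂ] EuclideanSpace ℂ (Fin Nm) :=
  Matrix.toEuclideanLin M.conjTranspose

theorem observation_apply {Nd Nm : ℕ} (M : Matrix (Fin Nd) (Fin Nm) ℂ)
    (x : EuclideanSpace ℂ (Fin Nd)) (i : Fin Nm) :
    observation M x i = (M.conjTranspose.mulVec (fun d => x d)) i := rfl

variable {Nd Np Nm : ℕ} {h : EuclideanSpace ℝ (Fin Np) → EuclideanSpace ℂ (Fin Nd)}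
  {θ : EuclideanSpace ℝ (Fin Np)} {σ : ℝ}

theorem real_inner_eq_re {n : ℕ} (x y : EuclideanSpace ℂ (Fin n)) :
    inner ℝ x y = (inner ℂ x y : ℂ).re := by
  simp only [PiLp.inner_apply, Complex.re_sum]
  rfl

theorem likelihood_eq (M : Matrix (Fin Nd) (Fin Nm) ℂ) (y : Fin Nm → ℂ) :
    likelihood h σ M θ y = ∏ i, circularDensity σ (y i - observation M (h θ) i) := rfl

theorem hasDerivAt_line (hh : DifferentiableAt ℝ h θ) (k : Fin Np) :
    HasDerivAt (fun t : ℝ => h (θ + t • EuclideanSpace.single k (1 : ℝ)))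
      (partialDeriv h θ k) 0 :=
  hh.lineDifferentiableAt.hasLineDerivAt

/-- Up to a constant, the log-likelihood is minus a sum of squared residuals over `σ ^ 2`, so its
derivative is linear in the residuals. -/
theorem score_eq (hh : DifferentiableAt ℝ h θ) (hσ : 0 < σ) (M : Matrix (Fin Nd) (Fin Nm) ℂ)
    (k : Fin Np) (y : Fin Nm → ℂ) :
    score h σ M θ k y = 2 / σ ^ 2 * ∑ i, inner ℝ (observation M (partialDeriv h θ k) i)
      (y i - observation M (h θ) i) := by
  have hL := hasDerivAt_line hh k
  have hc : ∀ i, HasDerivAt (fun t : ℝ => y i -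
      observation M (h (θ + t • EuclideanSpace.single k (1 : ℝ))) i)
      (-(observation M (partialDeriv h θ k) i)) 0 := by
    intro i
    let ℓ : EuclideanSpace ℂ (Fin Nd) →L[ℝ] ℂ := LinearMap.toContinuousLinearMap
      (((EuclideanSpace.projₗ (𝕜 := ℂ) i) ∘ₗ observation M).restrictScalars ℝ)
    exact (ℓ.hasFDerivAt.comp_hasDerivAt (0 : ℝ) hL).const_sub (y i)
  have hlog : ∀ ϑ, Real.log (likelihood h σ M ϑ y) =
      ∑ i, (Real.log (Real.pi * σ ^ 2)⁻¹ - ‖y i - observation M (h ϑ) i‖ ^ 2 / σ ^ 2) := by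
    intro ϑ
    rw [likelihood_eq, Real.log_prod]
    · refine Finset.sum_congr rfl fun i _ => ?_
      rw [circularDensity, Real.log_mul (by positivity) (by positivity), Real.log_exp]
      ring
    · intro i _
      unfold circularDensity
      positivity
  have hd := HasDerivAt.fun_sum (u := Finset.univ) fun i _ =>
    ((hc i).norm_sq.div_const (σ ^ 2)).const_sub (Real.log (Real.pi * σ ^ 2)⁻¹)
  rw [score, lineDeriv]
  simp_rw [hlog]
  rw [hd.deriv, Finset.mul_sum]
  refine Finset.sum_congr rfl fun i _ => ?_
  rw [zero_smul, add_zero, inner_neg_right, real_inner_comm]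
  ring

/-- Translating the observation by its mean leaves centred second moments; the constant is `(2 / σ ^
2) ^ 2 * (σ ^ 2 / 2)`. -/
theorem fisherInformation_eq (hh : DifferentiableAt ℝ h θ) (hσ : 0 < σ)
    (M : Matrix (Fin Nd) (Fin Nm) ℂ) (k l : Fin Np) :
    fisherInformation h σ M θ k l = 2 / σ ^ 2 *
      inner ℝ (observation M (partialDeriv h θ k)) (observation M (partialDeriv h θ l)) := by
  simp only [fisherInformation, Matrix.of_apply, score_eq hh hσ, likelihood_eq]
  have := integral_sub_right_eq_self (μ := volume) (fun z : Fin Nm → ℂ =>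
    2 / σ ^ 2 * (∑ i, inner ℝ (observation M (partialDeriv h θ k) i) (z i)) *
    (2 / σ ^ 2 * ∑ i, inner ℝ (observation M (partialDeriv h θ l) i) (z i)) *
      ∏ i, circularDensity σ (z i)) (fun i => observation M (h θ) i)
  simp only [Pi.sub_apply] at this
  rw [this]
  have e : ∀ z : Fin Nm → ℂ,
    2 / σ ^ 2 * (∑ i, inner ℝ (observation M (partialDeriv h θ k) i) (z i)) *
    (2 / σ ^ 2 * ∑ i, inner ℝ (observation M (partialDeriv h θ l) i) (z i)) *
      ∏ i, circularDensity σ (z i) = (2 / σ ^ 2) ^ 2 *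
      ((∑ i, inner ℝ (observation M (partialDeriv h θ k) i) (z i)) *
      (∑ i, inner ℝ (observation M (partialDeriv h θ l) i) (z i)) *
      ∏ i, circularDensity σ (z i)) := by intro z; ring
  simp_rw [e]
  rw [integral_const_mul, integral_sum_inner_mul_sum_inner hσ, PiLp.inner_apply]
  field_simp

end

/-! ### Reduction to an orthonormal basis, trace bound and column count -/

section

variable {Nd Np Nm : ℕ} {h : EuclideanSpace ℝ (Fin Np) → EuclideanSpace ℂ (Fin Nd)}
  {θ : EuclideanSpace ℝ (Fin Np)} {σ : ℝ}

/-- The real Gram matrix of the observations of a family of vectors. -/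
def observedGram (M : Matrix (Fin Nd) (Fin Nm) ℂ) (e : Fin Np → EuclideanSpace ℂ (Fin Nd)) :
    Matrix (Fin Np) (Fin Np) ℝ :=
  Matrix.of fun i j => inner ℝ (observation M (e i)) (observation M (e j))

theorem variationSpace_eq_span :
    variationSpace h θ = Submodule.span ℝ (Set.range (partialDeriv h θ)) :=
  Fintype.range_linearCombination ℝ _

theorem trace_gradientMatrix (F : Matrix (Fin Np) (Fin Np) ℝ) :
    (gradientMatrix h θ * F.map (fun x : ℝ => (x : ℂ)) *
      (gradientMatrix h θ).conjTranspose).trace.re =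
    (F * Matrix.of fun l k => inner ℝ (partialDeriv h θ l) (partialDeriv h θ k)).trace := by
  simp only [Matrix.trace, Matrix.diag, Matrix.mul_apply, Matrix.of_apply, Complex.re_sum,
    Matrix.map_apply, Matrix.conjTranspose_apply, gradientMatrix, PiLp.inner_apply, Finset.mul_sum,
    Finset.sum_mul]
  rw [Finset.sum_comm]
  simp_rw [Finset.sum_comm (s := (Finset.univ : Finset (Fin Nd)))]
  rw [Finset.sum_comm]
  refine Finset.sum_congr rfl fun k _ => Finset.sum_congr rfl fun l _ =>
    Finset.sum_congr rfl fun d _ => ?_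
  simp only [Complex.inner, RCLike.star_def, Complex.mul_re, Complex.ofReal_re, Complex.ofReal_im,
    Complex.conj_re, Complex.conj_im, Complex.mul_im]
  ring

/-- If `B` expresses the derivatives in the basis `e`, the Fisher matrix is a multiple of `Bᵀ A B`
and the Gram matrix of the derivatives is `Bᵀ B`; `B` cancels in the trace. It is invertible because
the two families span the same space. -/
theorem crb_eq_of_orthonormal (hh : DifferentiableAt ℝ h θ) (hσ : 0 < σ)
    (M : Matrix (Fin Nd) (Fin Nm) ℂ) {e : Fin Np → EuclideanSpace ℂ (Fin Nd)}
    (he : Orthonormal ℝ e) (hspan : Submodule.span ℝ (Set.range e) = variationSpace h θ) :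
    (IsUnit (observedGram M e).det → crb h σ θ M =
      ((σ ^ 2 / 2 * (observedGram M e)⁻¹.trace : ℝ) : EReal)) ∧
    (¬ IsUnit (observedGram M e).det → crb h σ θ M = ⊤) := by
  rw [variationSpace_eq_span] at hspan
  have hB : ∀ k, ∃ b : Fin Np → ℝ, ∑ i, b i • e i = partialDeriv h θ k := fun k => by
    rw [← Submodule.mem_span_range_iff_exists_fun, hspan]
    exact Submodule.subset_span ⟨k, rfl⟩
  have hC : ∀ i, ∃ c : Fin Np → ℝ, ∑ k, c k • partialDeriv h θ k = e i := fun i => by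
    rw [← Submodule.mem_span_range_iff_exists_fun, ← hspan]
    exact Submodule.subset_span ⟨i, rfl⟩
  choose b hb using hB
  choose c hc using hC
  set B : Matrix (Fin Np) (Fin Np) ℝ := Matrix.of fun i k => b k i with hBdef
  set C : Matrix (Fin Np) (Fin Np) ℝ := Matrix.of fun k i => c i k with hCdef
  set A := observedGram M e with hA
  set F := fisherInformation h σ M θ with hF
  have hBe : ∀ i k, b k i = inner ℝ (e i) (partialDeriv h θ k) := fun i k => by
    rw [← hb k, he.inner_right_fintype]
  have hBC : B * C = 1 := by
    ext i j
    rw [Matrix.mul_apply]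
    simp only [hBdef, hCdef, Matrix.of_apply, hBe]
    have : inner ℝ (e i) (e j) = (1 : Matrix (Fin Np) (Fin Np) ℝ) i j := by
      rw [orthonormal_iff_ite.1 he i j, Matrix.one_apply]
    rw [← this, ← hc j, inner_sum]
    exact Finset.sum_congr rfl fun k _ => by rw [real_inner_smul_right, mul_comm]
  have hCB : C * B = 1 := mul_eq_one_comm.1 hBC
  have hG : (Matrix.of fun l k => inner ℝ (partialDeriv h θ l) (partialDeriv h θ k)) =
      B.transpose * B := by
    ext l k
    rw [Matrix.mul_apply, Matrix.of_apply]
    nth_rw 1 [← hb l]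
    rw [sum_inner]
    refine Finset.sum_congr rfl fun i _ => ?_
    rw [real_inner_smul_left, ← hBe]
    rfl
  have hFA : F = (2 / σ ^ 2) • (B.transpose * A * B) := by
    ext k l
    rw [hF, fisherInformation_eq hh hσ, Matrix.smul_apply, smul_eq_mul, ← hb k, ← hb l]
    congr 1
    simp only [map_sum, Matrix.mul_apply, Matrix.transpose_apply, hBdef, Matrix.of_apply, hA,
      observedGram, Finset.sum_mul, LinearMap.map_smul_of_tower, sum_inner, inner_sum,
      real_inner_smul_left, real_inner_smul_right]
    refine Finset.sum_congr rfl fun i _ => Finset.sum_congr rfl fun j _ => by ring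
  have hdetB : IsUnit B.det := Matrix.isUnit_det_of_right_inverse hBC
  have hdet : IsUnit F.det ↔ IsUnit A.det := by
    rw [isUnit_iff_ne_zero] at hdetB
    rw [isUnit_iff_ne_zero, isUnit_iff_ne_zero, hFA, Matrix.det_smul, Matrix.det_mul,
      Matrix.det_mul, Matrix.det_transpose]
    have : (2 / σ ^ 2) ^ Fintype.card (Fin Np) ≠ 0 := by positivity
    simp [hdetB, hσ.ne']
  constructor
  · intro hu
    have hinv : F⁻¹ = (σ ^ 2 / 2) • (C * A⁻¹ * C.transpose) := by
      refine Matrix.inv_eq_right_inv ?_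
      rw [hFA, Matrix.smul_mul, Matrix.mul_smul, smul_smul,
        show 2 / σ ^ 2 * (σ ^ 2 / 2) = 1 by field_simp, one_smul]
      calc _ = B.transpose * (A * ((B * C) * A⁻¹)) * C.transpose := by
            simp only [Matrix.mul_assoc]
        _ = 1 := by
            rw [hBC, Matrix.one_mul, Matrix.mul_nonsing_inv _ hu, Matrix.mul_one,
              ← Matrix.transpose_mul, hCB, Matrix.transpose_one]
    rw [crb, if_pos (hdet.2 hu), trace_gradientMatrix, hG, hinv, Matrix.smul_mul,
      Matrix.trace_smul, smul_eq_mul]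
    congr 2
    calc _ = (C * (A⁻¹ * ((C.transpose * B.transpose) * B))).trace := by
          simp only [Matrix.mul_assoc]
      _ = _ := by
          rw [← Matrix.transpose_mul, hBC, Matrix.transpose_one, Matrix.one_mul,
            Matrix.trace_mul_comm, Matrix.mul_assoc, hBC, Matrix.mul_one]
  · intro hu
    rw [crb, if_neg (hdet.not.2 hu)]

/-- The quadratic form of `A` is nonnegative at `A⁻¹ eᵢ - s i • eᵢ`; expanding it bounds each
diagonal entry of `A⁻¹`. Equality holds for diagonal `A` with `s i = 1 / A i i`. -/
theorem trace_inv_ge {n : ℕ} {A : Matrix (Fin n) (Fin n) ℝ} (hA : A.PosSemidef)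
    (hu : IsUnit A.det) (s : Fin n → ℝ) : ∑ i, (2 * s i - s i ^ 2 * A i i) ≤ A⁻¹.trace := by
  refine Finset.sum_le_sum fun i _ => ?_
  have hsym : A.transpose = A := hA.1
  have key := hA.dotProduct_mulVec_nonneg (A⁻¹.mulVec (Pi.single i 1) - s i • Pi.single i 1)
  have h1 : A.mulVec (A⁻¹.mulVec (Pi.single i 1)) = Pi.single i 1 := by
    rw [Matrix.mulVec_mulVec, Matrix.mul_nonsing_inv _ hu, Matrix.one_mulVec]
  have hsymi : A⁻¹.transpose = A⁻¹ := by rw [Matrix.transpose_nonsing_inv, hsym]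
  have h2 : A⁻¹.mulVec (Pi.single i 1) ⬝ᵥ A.mulVec (Pi.single i 1) = 1 := by
    rw [Matrix.dotProduct_mulVec, ← Matrix.mulVec_transpose, hsym, h1]
    simp
  rw [star_trivial, Matrix.mulVec_sub, h1, Matrix.mulVec_smul, sub_dotProduct, dotProduct_sub,
    dotProduct_sub, smul_dotProduct, smul_dotProduct, dotProduct_smul, dotProduct_smul, h2] at key
  simp only [dotProduct_single, single_dotProduct, Matrix.mulVec_single_one, Matrix.col_apply, Pi.single_eq_same,
    smul_eq_mul, mul_one, one_mul] at key
  simp only [Matrix.diag_apply]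
  nlinarith [key]

theorem observedGram_posSemidef (M : Matrix (Fin Nd) (Fin Nm) ℂ)
    (e : Fin Np → EuclideanSpace ℂ (Fin Nd)) : (observedGram M e).PosSemidef := by
  refine Matrix.PosSemidef.of_dotProduct_mulVec_nonneg ?_ fun x => ?_
  · ext i j
    simp [observedGram, real_inner_comm]
  · have : star x ⬝ᵥ (observedGram M e).mulVec x =
        inner ℝ (∑ i, x i • observation M (e i)) (∑ i, x i • observation M (e i)) := by
      simp only [dotProduct, Matrix.mulVec, observedGram, Matrix.of_apply, sum_inner, inner_sum,
        real_inner_smul_left, real_inner_smul_right, star_trivial, Finset.mul_sum]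
      refine Finset.sum_congr rfl fun i _ => Finset.sum_congr rfl fun j _ => ?_
      rw [real_inner_comm]
      ring
    rw [this]
    exact real_inner_self_nonneg

/-- The `j`-th column of a matrix, as a vector of the Hermitian space. -/
def column (M : Matrix (Fin Nd) (Fin Nm) ℂ) (j : Fin Nm) : EuclideanSpace ℂ (Fin Nd) :=
  WithLp.toLp 2 fun i => M i j

theorem observation_eq_inner (M : Matrix (Fin Nd) (Fin Nm) ℂ) (x : EuclideanSpace ℂ (Fin Nd))
    (j : Fin Nm) : observation M x j = inner ℂ (column M j) x := by
  rw [observation_apply, PiLp.inner_apply]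
  simp [Matrix.mulVec, dotProduct, column, mul_comm]

theorem frobeniusSq_eq_sum_column (M : Matrix (Fin Nd) (Fin Nm) ℂ) :
    frobeniusSq M = ∑ j, ‖column M j‖ ^ 2 := by
  rw [frobeniusSq, Finset.sum_comm]
  simp only [EuclideanSpace.norm_sq_eq]
  rfl

theorem le_trace_inv_observedGram {M : Matrix (Fin Nd) (Fin Nm) ℂ} {P : ℝ} (hP : 0 < P)
    (hM : frobeniusSq M = P) {e : Fin Np → EuclideanSpace ℂ (Fin Nd)} {t : Fin Np → ℝ}
    (ht : ∀ x : EuclideanSpace ℂ (Fin Nd), ∑ i, t i ^ 2 * ‖(inner ℂ (e i) x : ℂ)‖ ^ 2 ≤ ‖x‖ ^ 2)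
    (hu : IsUnit (observedGram M e).det) :
    (∑ i, t i) ^ 2 / P ≤ (observedGram M e)⁻¹.trace := by
  have hP' : ∑ i, t i ^ 2 * observedGram M e i i ≤ P := by
    rw [← hM, frobeniusSq_eq_sum_column]
    -- A diagonal Gram entry is the energy that the columns of `M` put on `e i`, so Bessel can be
    -- applied column by column.
    have : ∀ i, observedGram M e i i = ∑ j, ‖(inner ℂ (e i) (column M j) : ℂ)‖ ^ 2 := fun i => by
      rw [observedGram, Matrix.of_apply, real_inner_self_eq_norm_sq, EuclideanSpace.norm_sq_eq]
      exact Finset.sum_congr rfl fun j _ => by rw [observation_eq_inner, norm_inner_symm]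
    simp_rw [this, Finset.mul_sum]
    rw [Finset.sum_comm]
    exact Finset.sum_le_sum fun j _ => ht _
  set C := ∑ i, t i with hC
  refine le_trans ?_ (trace_inv_ge (observedGram_posSemidef M e) hu fun i => C / P * t i)
  have : ∑ i, (2 * (C / P * t i) - (C / P * t i) ^ 2 * observedGram M e i i) =
      2 * (C / P) * C - (C / P) ^ 2 * ∑ i, t i ^ 2 * observedGram M e i i := by
    rw [Finset.sum_sub_distrib, hC, Finset.mul_sum, Finset.mul_sum]
    congr 1 <;> refine Finset.sum_congr rfl fun i _ => by ring
  rw [this]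
  have h2 := mul_le_mul_of_nonneg_left hP' (sq_nonneg (C / P))
  have h3 : (C / P) ^ 2 * P = C ^ 2 / P := by field_simp
  have h4 : 2 * (C / P) * C = 2 * (C ^ 2 / P) := by ring
  linarith

/-- A real linear relation between the observed derivatives is a kernel vector of the Fisher matrix.
-/
theorem le_two_mul_columns_of_crb_ne_top (hh : DifferentiableAt ℝ h θ) (hσ : 0 < σ)
    {M : Matrix (Fin Nd) (Fin Nm) ℂ} (hM : crb h σ θ M ≠ ⊤) : Np ≤ 2 * Nm := by
  have hu : IsUnit (fisherInformation h σ M θ).det := by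
    by_contra hu
    exact hM (if_neg hu)
  have hli : LinearIndependent ℝ fun k => observation M (partialDeriv h θ k) := by
    rw [Fintype.linearIndependent_iff]
    intro x hx
    have h0 : (fisherInformation h σ M θ).mulVec x = 0 := by
      ext k
      simp only [Matrix.mulVec, dotProduct, fisherInformation_eq hh hσ, Pi.zero_apply]
      have : ∑ l, 2 / σ ^ 2 * inner ℝ (observation M (partialDeriv h θ k))
          (observation M (partialDeriv h θ l)) * x l = 2 / σ ^ 2 *
          inner ℝ (observation M (partialDeriv h θ k))
            (∑ l, x l • observation M (partialDeriv h θ l)) := by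
        rw [inner_sum, Finset.mul_sum]
        exact Finset.sum_congr rfl fun l _ => by rw [real_inner_smul_right]; ring
      rw [this, hx, inner_zero_right, mul_zero]
    have : x = 0 := by
      by_contra hx0
      exact hu.ne_zero (Matrix.exists_mulVec_eq_zero_iff.1 ⟨x, hx0, h0⟩)
    exact fun k => congrFun this k
  have := hli.fintype_card_le_finrank
  have hf : Module.finrank ℝ (EuclideanSpace ℂ (Fin Nm)) = 2 * Nm := by
    rw [finrank_real_of_complex, finrank_euclideanSpace_fin]
  rwa [Fintype.card_fin, hf] at this

end

/-! ### Existence of a decomposition -/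

section

variable {d : ℕ}

/-- The compression to a real subspace `V` of the multiplication by the imaginary unit. -/
def compressedI (V : Submodule ℝ (EuclideanSpace ℂ (Fin d))) : V →ₗ[ℝ] V :=
  V.orthogonalProjectionOnto.toLinearMap ∘ₗ
    ((Complex.I • (LinearMap.id : EuclideanSpace ℂ (Fin d) →ₗ[ℂ] _)).restrictScalars ℝ) ∘ₗ
    V.subtype

/-- The projection is invisible when paired with a vector of `V`. The compressed operator thus
records the imaginary part of the Hermitian product, which is antisymmetric. -/
theorem inner_compressedI (V : Submodule ℝ (EuclideanSpace ℂ (Fin d))) (x y : V) :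
    inner ℝ (compressedI V x) y =
      (inner ℂ (x : EuclideanSpace ℂ (Fin d)) (y : EuclideanSpace ℂ (Fin d)) : ℂ).im := by
  have : compressedI V x = V.orthogonalProjectionOnto (Complex.I • (x : EuclideanSpace ℂ (Fin d))) :=
    rfl
  rw [this, Submodule.inner_orthogonalProjectionOnto_eq_of_mem_right, real_inner_eq_re,
    inner_smul_left]
  simp

theorem inner_compressedI_right (V : Submodule ℝ (EuclideanSpace ℂ (Fin d))) (x y : V) :
    inner ℝ x (compressedI V y) = -inner ℝ (compressedI V x) y := by
  rw [real_inner_comm, inner_compressedI, inner_compressedI, ← inner_conj_symm, Complex.conj_im]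

/-- The square of a skew operator is symmetric, hence diagonalizable. An eigenvector `b` of `J ∘ J`
with `J b ≠ 0` has eigenvalue `-‖J b‖ ^ 2`, so `b` and `J b` span an invariant plane. If there is
none in the eigenbasis, `J = 0` and any two basis vectors serve with `c = 0`. -/
theorem exists_orthonormal_of_skew {F : Type*} [NormedAddCommGroup F] [InnerProductSpace ℝ F]
    [FiniteDimensional ℝ F] (hF : 2 ≤ Module.finrank ℝ F) (J : F →ₗ[ℝ] F)
    (hJ : ∀ x y, inner ℝ x (J y) = -inner ℝ (J x) y) :
    ∃ (v w : F) (c : ℝ), 0 ≤ c ∧ ‖v‖ = 1 ∧ ‖w‖ = 1 ∧ inner ℝ v w = 0 ∧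
      J v = -c • w ∧ J w = c • v := by
  have hT : (J ∘ₗ J).IsSymmetric := fun x y => by
    rw [LinearMap.comp_apply, LinearMap.comp_apply, hJ, real_inner_comm, hJ, real_inner_comm]
  let b := hT.eigenvectorBasis rfl
  by_cases h : ∃ i, J (b i) ≠ 0
  · obtain ⟨i, hi⟩ := h
    have hb1 : ‖b i‖ = 1 := b.orthonormal.1 i
    have hc : 0 < ‖J (b i)‖ := norm_pos_iff.2 hi
    have heig : J (J (b i)) = hT.eigenvalues rfl i • b i := hT.apply_eigenvectorBasis rfl i
    have hlam : hT.eigenvalues rfl i = -‖J (b i)‖ ^ 2 := by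
      have h1 : inner ℝ (J (J (b i))) (b i) = -‖J (b i)‖ ^ 2 := by
        rw [← real_inner_self_eq_norm_sq, hJ, neg_neg]
      rw [heig, real_inner_smul_left, real_inner_self_eq_norm_sq, hb1] at h1
      linarith
    have hperp : inner ℝ (b i) (J (b i)) = 0 := by
      have := hJ (b i) (b i)
      rw [real_inner_comm (b i)] at this
      linarith
    refine ⟨b i, -(‖J (b i)‖⁻¹ • J (b i)), ‖J (b i)‖, hc.le, hb1, ?_, ?_, ?_, ?_⟩
    · rw [norm_neg, norm_smul, norm_inv, norm_norm, inv_mul_cancel₀ hc.ne']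
    · rw [inner_neg_right, real_inner_smul_right, hperp, mul_zero, neg_zero]
    · rw [smul_neg, neg_smul, neg_neg, smul_smul, mul_inv_cancel₀ hc.ne', one_smul]
    · rw [map_neg, map_smul, heig, hlam, smul_smul, ← neg_smul]
      congr 1
      field_simp
  · push Not at h
    have h0 : 0 < Module.finrank ℝ F := by omega
    refine ⟨b ⟨0, h0⟩, b ⟨1, hF⟩, 0, le_rfl, b.orthonormal.1 _, b.orthonormal.1 _,
      b.orthonormal.2 (by simp), ?_, ?_⟩
    · rw [h]; simp
    · rw [h]; simp

/-- On `V`, the imaginary parts of the products with `v` and `w` are multiples of the real products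
with `w` and `v`, since the plane is invariant. This upgrades real orthogonality to complex
orthogonality. The bound `c ≤ 1` is Cauchy–Schwarz. -/
theorem exists_plane (V : Submodule ℝ (EuclideanSpace ℂ (Fin d)))
    (hV : 2 ≤ Module.finrank ℝ V) :
    ∃ (v w : EuclideanSpace ℂ (Fin d)) (c : ℝ), v ∈ V ∧ w ∈ V ∧ 0 ≤ c ∧ c ≤ 1 ∧
      inner ℂ v v = (1 : ℂ) ∧ inner ℂ w w = (1 : ℂ) ∧ inner ℂ v w = -(Complex.I * (c : ℂ)) ∧
      ∀ z ∈ V, inner ℝ v z = 0 → inner ℝ w z = 0 →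
        inner ℂ v z = (0 : ℂ) ∧ inner ℂ w z = (0 : ℂ) := by
  obtain ⟨v, w, c, hc, hv, hw, hvw, hJv, hJw⟩ := exists_orthonormal_of_skew (F := V) hV (compressedI V)
    (inner_compressedI_right V)
  have him (z : V) : (inner ℂ (v : EuclideanSpace ℂ (Fin d)) (z : EuclideanSpace ℂ (Fin d)) : ℂ).im =
      -c * inner ℝ w z := by
    rw [← inner_compressedI, hJv]
    exact real_inner_smul_left _ _ _
  have him' (z : V) : (inner ℂ (w : EuclideanSpace ℂ (Fin d)) (z : EuclideanSpace ℂ (Fin d)) : ℂ).im =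
      c * inner ℝ v z := by
    rw [← inner_compressedI, hJw]
    exact real_inner_smul_left _ _ _
  have hv' : ‖(v : EuclideanSpace ℂ (Fin d))‖ = 1 := hv
  have hw' : ‖(w : EuclideanSpace ℂ (Fin d))‖ = 1 := hw
  have hip : inner ℂ (v : EuclideanSpace ℂ (Fin d)) (w : EuclideanSpace ℂ (Fin d)) =
      -(Complex.I * (c : ℂ)) := by
    apply Complex.ext
    · rw [← real_inner_eq_re, ← Submodule.coe_inner, hvw]; simp
    · rw [him, real_inner_self_eq_norm_sq, hw]; simp
  refine ⟨v, w, c, v.2, w.2, hc, ?_, ?_, ?_, hip, ?_⟩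
  · have := norm_inner_le_norm (𝕜 := ℂ) (v : EuclideanSpace ℂ (Fin d)) (w : EuclideanSpace ℂ (Fin d))
    rw [hip, hv', hw'] at this
    simpa [abs_of_nonneg hc] using this
  · rw [inner_self_eq_norm_sq_to_K, hv']; simp
  · rw [inner_self_eq_norm_sq_to_K, hw']; simp
  · intro z hz h1 h2
    have h1' : inner ℝ v (⟨z, hz⟩ : V) = 0 := h1
    have h2' : inner ℝ w (⟨z, hz⟩ : V) = 0 := h2
    constructor <;> apply Complex.ext
    · rw [← real_inner_eq_re, h1]; simp
    · rw [him ⟨z, hz⟩, h2']; simp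
    · rw [← real_inner_eq_re, h2]; simp
    · rw [him' ⟨z, hz⟩, h1']; simp

/-- Induction on the number of planes: split one off and apply the hypothesis to its real orthogonal
complement in `V`. The base case is zero or a line. -/
theorem exists_decomposition (q : ℕ) : ∀ (p : ℕ), p = q ∨ p = q + 1 →
    ∀ V : Submodule ℝ (EuclideanSpace ℂ (Fin d)), Module.finrank ℝ V = q + p →
    ∃ (v : Fin p → EuclideanSpace ℂ (Fin d)) (w : Fin q → EuclideanSpace ℂ (Fin d))
      (c : Fin q → ℝ), Submodule.span ℝ (Set.range v ∪ Set.range w) = V ∧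
      (∀ m n, inner ℂ (v m) (v n) = if m = n then (1 : ℂ) else 0) ∧
      (∀ m n, inner ℂ (w m) (w n) = if m = n then (1 : ℂ) else 0) ∧
      (∀ m n, inner ℂ (v m) (w n) = if (m : ℕ) = (n : ℕ) then -(Complex.I * (c n : ℂ)) else 0) ∧
      (∀ k, 0 ≤ c k) ∧ (∀ k, c k ≤ 1) := by
  induction q with
  | zero =>
    rintro p (rfl | rfl) V hV
    · refine ⟨Fin.elim0, Fin.elim0, Fin.elim0, ?_, fun m => m.elim0, fun m => m.elim0,
        fun m => m.elim0, fun m => m.elim0, fun m => m.elim0⟩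
      rw [Submodule.finrank_eq_zero.1 hV]
      simp
    · have hpos : 0 < Module.finrank ℝ V := by omega
      have := Module.finrank_pos_iff.1 hpos
      obtain ⟨x, hx⟩ := exists_norm_eq V zero_le_one
      have hx' : ‖(x : EuclideanSpace ℂ (Fin d))‖ = 1 := hx
      refine ⟨fun _ => x, Fin.elim0, Fin.elim0, ?_, fun m n => ?_, fun m => m.elim0,
        fun _ m => m.elim0, fun m => m.elim0, fun m => m.elim0⟩
      · have hle : Submodule.span ℝ {(x : EuclideanSpace ℂ (Fin d))} ≤ V := by
          simp
        have hne : (x : EuclideanSpace ℂ (Fin d)) ≠ 0 := norm_ne_zero_iff.1 (by rw [hx']; simp)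
        have := Submodule.eq_of_le_of_finrank_eq hle (by rw [finrank_span_singleton hne, hV])
        refine Eq.trans ?_ this
        congr 1
        ext y
        simp
      · rw [inner_self_eq_norm_sq_to_K, hx', if_pos (by omega)]; simp
  | succ q ih =>
    intro p hp V hV
    obtain ⟨p, rfl⟩ : ∃ p', p = p' + 1 := ⟨p - 1, by omega⟩
    obtain ⟨v₀, w₀, c₀, hv₀, hw₀, hc0, hc1, hvv, hww, hvw, hz⟩ := exists_plane V (by omega)
    set W : Submodule ℝ (EuclideanSpace ℂ (Fin d)) := Submodule.span ℝ {v₀, w₀} with hW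
    have hWV : W ≤ V := by
      rw [hW, Submodule.span_le]
      rintro x (rfl | rfl)
      exacts [hv₀, hw₀]
    have hW2 : Module.finrank ℝ W = 2 := by
      have ho : Orthonormal ℝ ![v₀, w₀] := by
        rw [orthonormal_iff_ite]
        intro i j
        fin_cases i <;> fin_cases j <;>
          simp [-inner_self_eq_norm_sq_to_K, real_inner_eq_re,
            hvv, hww, hvw]
        rw [← inner_conj_symm, hvw]
        simp
      have := finrank_span_eq_card ho.linearIndependent
      rw [Matrix.range_cons_cons_empty] at this
      simpa using this
    have hdim := Submodule.finrank_add_inf_finrank_orthogonal hWV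
    obtain ⟨v, w, c, hs, h1, h2, h3, h4, h5⟩ := ih p (by omega) (Wᗮ ⊓ V) (by omega)
    have hmem : ∀ z ∈ Wᗮ ⊓ V, inner ℂ v₀ z = (0 : ℂ) ∧ inner ℂ w₀ z = (0 : ℂ) := fun z hzm =>
      hz z hzm.2 (hzm.1 v₀ (Submodule.subset_span (by simp)))
        (hzm.1 w₀ (Submodule.subset_span (by simp)))
    have hv : ∀ m, inner ℂ v₀ (v m) = (0 : ℂ) ∧ inner ℂ w₀ (v m) = (0 : ℂ) := fun m =>
      hmem _ (hs ▸ Submodule.subset_span (Or.inl ⟨m, rfl⟩))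
    have hw : ∀ m, inner ℂ v₀ (w m) = (0 : ℂ) ∧ inner ℂ w₀ (w m) = (0 : ℂ) := fun m =>
      hmem _ (hs ▸ Submodule.subset_span (Or.inr ⟨m, rfl⟩))
    refine ⟨Fin.cons v₀ v, Fin.cons w₀ w, Fin.cons c₀ c, ?_, fun m n => ?_, fun m n => ?_,
      fun m n => ?_, fun k => ?_, fun k => ?_⟩
    · rw [Fin.range_cons, Fin.range_cons, ← Submodule.sup_orthogonal_inf_of_hasOrthogonalProjection hWV,
        ← hs, hW, ← Submodule.span_union]
      congr 1
      ext x
      simp only [Set.mem_union, Set.mem_insert_iff, Set.mem_singleton_iff]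
      tauto
    · induction m using Fin.cases <;> induction n using Fin.cases <;>
        simp [-inner_self_eq_norm_sq_to_K, hvv, h1, hv, inner_eq_zero_symm.1 (hv _).1, (Fin.succ_ne_zero _).symm]
    · induction m using Fin.cases <;> induction n using Fin.cases <;>
        simp [-inner_self_eq_norm_sq_to_K, hww, h2, hw, inner_eq_zero_symm.1 (hw _).2, (Fin.succ_ne_zero _).symm]
    · induction m using Fin.cases <;> induction n using Fin.cases <;>
        simp [hvw, h3, hw, inner_eq_zero_symm.1 (hv _).2]
    · induction k using Fin.cases <;> simp [hc0, h4]
    · induction k using Fin.cases <;> simp [hc1, h5]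

theorem exists_isDecomposition {Np : ℕ} (V : Submodule ℝ (EuclideanSpace ℂ (Fin d)))
    (hV : Module.finrank ℝ V = Np) : ∃ v w c, IsDecomposition Np V v w c := by
  obtain ⟨v, w, c, h0, h1, h2, h3, h4, h5⟩ :=
    exists_decomposition (Np / 2) ((Np + 1) / 2) (by omega) V (by omega)
  exact ⟨v, w, c, h0, h1, h2, h3, h4, h5⟩

end

/-! ### Weighted Bessel inequality, optimal matrix and conclusion -/

section

/-- If `v k`, `w k` generate mutually orthogonal planes with angle parameters `c k`, the weighted
Bessel inequality holds with weights `1 / (1 + c k)`. -/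
theorem weighted_bessel {E : Type*} [NormedAddCommGroup E] [InnerProductSpace ℂ E] {p : ℕ}
    {v w : Fin p → E} {c : Fin p → ℝ} (hc : ∀ k, 0 ≤ c k)
    (hv : ∀ k, ‖v k‖ ≤ 1) (hw : ∀ k, ‖w k‖ ≤ 1)
    (hvv : ∀ m n, m ≠ n → inner ℂ (v m) (v n) = (0 : ℂ))
    (hww : ∀ m n, m ≠ n → inner ℂ (w m) (w n) = (0 : ℂ))
    (hvw : ∀ m n, inner ℂ (v m) (w n) = if m = n then -(Complex.I * (c n : ℂ)) else 0) (x : E) :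
    ∑ k, (‖(inner ℂ (v k) x : ℂ)‖ ^ 2 + ‖(inner ℂ (w k) x : ℂ)‖ ^ 2) / (1 + c k) ≤ ‖x‖ ^ 2 := by
  set a : Fin p → ℂ := fun k => inner ℂ (v k) x with ha
  set b : Fin p → ℂ := fun k => inner ℂ (w k) x with hb
  have hpos : ∀ k, 0 < 1 + c k := fun k => by linarith [hc k]
  set y : Fin p → E := fun k => a k • v k + b k • w k with hy
  -- The cross term is at most `2 * c k * ‖a k‖ * ‖b k‖`, hence at most `c k * (‖a k‖ ^ 2 + ‖b k‖ ^
  -- 2)`.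
  have hnorm : ∀ k, ‖y k‖ ^ 2 ≤ (1 + c k) * (‖a k‖ ^ 2 + ‖b k‖ ^ 2) := fun k => by
    rw [hy, @norm_add_sq ℂ, norm_smul, norm_smul, inner_smul_left, inner_smul_right, hvw, if_pos rfl]
    have h1 : RCLike.re ((starRingEnd ℂ) (a k) * (b k * -(Complex.I * (c k : ℂ)))) ≤
        ‖a k‖ * ‖b k‖ * c k := by
      refine (RCLike.re_le_norm _).trans (le_of_eq ?_)
      simp [abs_of_nonneg (hc k), mul_assoc]
    have h2 : (‖a k‖ * ‖v k‖) ^ 2 ≤ ‖a k‖ ^ 2 :=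
      pow_le_pow_left₀ (by positivity) (mul_le_of_le_one_right (norm_nonneg _) (hv k)) 2
    have h3 : (‖b k‖ * ‖w k‖) ^ 2 ≤ ‖b k‖ ^ 2 :=
      pow_le_pow_left₀ (by positivity) (mul_le_of_le_one_right (norm_nonneg _) (hw k)) 2
    have h4 := mul_nonneg (hc k) (sq_nonneg (‖a k‖ - ‖b k‖))
    linarith
  have horth : ∀ m n, m ≠ n → inner ℂ (y m) (y n) = (0 : ℂ) := fun m n hmn => by
    have hwv : inner ℂ (w m) (v n) = (0 : ℂ) :=
      inner_eq_zero_symm.1 (by rw [hvw, if_neg hmn.symm])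
    simp only [hy, inner_add_left, inner_add_right, inner_smul_left, inner_smul_right, hvv m n hmn,
      hww m n hmn, hvw, if_neg hmn, hwv, mul_zero, add_zero]
  set S := ∑ k, (‖a k‖ ^ 2 + ‖b k‖ ^ 2) / (1 + c k) with hS
  -- This vector satisfies `re ⟪x, z⟫ = S` and `‖z‖ ^ 2 ≤ S`, so `0 ≤ ‖x - z‖ ^ 2` gives `S ≤ ‖x‖ ^
  -- 2`.
  set z : E := ∑ k, (((1 + c k)⁻¹ : ℝ) : ℂ) • y k with hz
  have hzx : RCLike.re (inner ℂ x z : ℂ) = S := by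
    rw [hz, inner_sum, map_sum]
    refine Finset.sum_congr rfl fun k _ => ?_
    have h1 : (inner ℂ x (v k) : ℂ) = starRingEnd ℂ (a k) := (inner_conj_symm _ _).symm
    have h2 : (inner ℂ x (w k) : ℂ) = starRingEnd ℂ (b k) := (inner_conj_symm _ _).symm
    rw [inner_smul_right, hy, inner_add_right, inner_smul_right, inner_smul_right, h1, h2,
      Complex.mul_conj, Complex.mul_conj, Complex.normSq_eq_norm_sq, Complex.normSq_eq_norm_sq,
      ← Complex.ofReal_add, ← Complex.ofReal_mul]
    exact (Complex.ofReal_re _).trans (div_eq_inv_mul _ _).symm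
  have hzz : ‖z‖ ^ 2 ≤ S := by
    rw [@norm_sq_eq_re_inner ℂ, hz, sum_inner, map_sum]
    refine Finset.sum_le_sum fun k _ => ?_
    rw [inner_sum, Finset.sum_eq_single k, ← @norm_sq_eq_re_inner ℂ, norm_smul, mul_pow,
      Complex.norm_real, Real.norm_of_nonneg (inv_nonneg.2 (hpos k).le)]
    · calc _ ≤ (1 + c k)⁻¹ ^ 2 * ((1 + c k) * (‖a k‖ ^ 2 + ‖b k‖ ^ 2)) :=
            mul_le_mul_of_nonneg_left (hnorm k) (sq_nonneg _)
        _ = _ := by have := (hpos k).ne'; field_simp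
    · intro l _ hl
      rw [inner_smul_left, inner_smul_right, horth k l hl.symm, mul_zero, mul_zero]
    · simp
  have := @norm_sub_sq ℂ _ _ _ _ x z
  rw [hzx] at this
  linarith [sq_nonneg ‖x - z‖]

theorem sum_fin_eq_sum_castLE {p q : ℕ} (s : ℕ) (hp : p = q + s) (g : Fin p → ℝ) (r : ℝ)
    (hr : ∀ k : Fin p, q ≤ k → g k = r) :
    ∑ k, g k = ∑ k : Fin q, g (Fin.castLE (by omega) k) + s * r := by
  subst hp
  rw [Fin.sum_univ_add]
  congr 1
  rw [Finset.sum_congr rfl fun k _ => hr (Fin.natAdd q k) (by simp)]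
  simp

/-- Extension of a family by zero to the possible unpaired last index. -/
def extendZero {α : Type*} [Zero α] {Np : ℕ} (f : Fin (Np / 2) → α) : Fin ((Np + 1) / 2) → α :=
  fun k => if hk : (k : ℕ) < Np / 2 then f ⟨k, hk⟩ else 0

theorem half_le_half (Np : ℕ) : Np / 2 ≤ (Np + 1) / 2 := by omega

theorem extendZero_castLE {α : Type*} [Zero α] {Np : ℕ} (f : Fin (Np / 2) → α)
    (k : Fin (Np / 2)) : extendZero f (Fin.castLE (half_le_half Np) k) = f k := by
  simp [extendZero]

theorem extendZero_of_le {α : Type*} [Zero α] {Np : ℕ} (f : Fin (Np / 2) → α)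
    (k : Fin ((Np + 1) / 2)) (hk : Np / 2 ≤ k) : extendZero f k = 0 := by
  simp [extendZero, hk]

theorem extendZero_nonneg {Np : ℕ} {f : Fin (Np / 2) → ℝ} (hf : ∀ k, 0 ≤ f k)
    (k : Fin ((Np + 1) / 2)) : 0 ≤ extendZero f k := by
  unfold extendZero
  split_ifs
  exacts [hf _, le_rfl]

theorem sum_half {Np : ℕ} (g : Fin ((Np + 1) / 2) → ℝ) (r : ℝ)
    (hr : ∀ k : Fin ((Np + 1) / 2), Np / 2 ≤ k → g k = r) :
    ∑ k, g k = ∑ k, g (Fin.castLE (half_le_half Np) k) + ((Np % 2 : ℕ) : ℝ) * r :=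
  sum_fin_eq_sum_castLE (Np % 2) (by omega) g r hr

/-- The indices `1, …, Np` split into those of the `v` and those of the `w`. -/
def splitIndex (Np : ℕ) : Fin Np ≃ Fin ((Np + 1) / 2) ⊕ Fin (Np / 2) :=
  (finCongr (by omega)).trans finSumFinEquiv.symm

theorem sum_splitIndex {Np : ℕ} (g : Fin ((Np + 1) / 2) ⊕ Fin (Np / 2) → ℝ) :
    ∑ i, g (splitIndex Np i) = ∑ k, g (Sum.inl k) + ∑ k, g (Sum.inr k) := by
  rw [(splitIndex Np).sum_comp, Fintype.sum_sum_type]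

/-- The weights `1 / √(1 + c_k)` attached to the vectors `v_k` and `w_k`. -/
def weight {Np : ℕ} (c : Fin (Np / 2) → ℝ) : Fin ((Np + 1) / 2) ⊕ Fin (Np / 2) → ℝ :=
  Sum.elim (fun k => 1 / √(1 + extendZero c k)) (fun k => 1 / √(1 + c k))

theorem sum_weight {Np : ℕ} (c : Fin (Np / 2) → ℝ) :
    ∑ i, weight c (splitIndex Np i) = normConst Np c := by
  rw [sum_splitIndex, normConst]
  simp only [weight, Sum.elim_inl, Sum.elim_inr]
  rw [sum_half _ 1 fun k hk => by simp [extendZero_of_le c k hk]]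
  simp only [extendZero_castLE]
  ring

theorem weight_pos {Np : ℕ} {c : Fin (Np / 2) → ℝ} (hc : ∀ k, 0 ≤ c k)
    (i : Fin ((Np + 1) / 2) ⊕ Fin (Np / 2)) : 0 < weight c i := by
  rcases i with k | k
  · have := extendZero_nonneg hc k
    simp only [weight, Sum.elim_inl]; positivity
  · have := hc k
    simp only [weight, Sum.elim_inr]; positivity

theorem normConst_pos {Np : ℕ} (hNp : 0 < Np) {c : Fin (Np / 2) → ℝ} (hc : ∀ k, 0 ≤ c k) :
    0 < normConst Np c := by
  have : Nonempty (Fin Np) := ⟨⟨0, hNp⟩⟩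
  rw [← sum_weight]
  exact Finset.sum_pos (fun i _ => weight_pos hc _) Finset.univ_nonempty

namespace IsDecomposition

variable {Nd Np : ℕ} {V : Submodule ℝ (EuclideanSpace ℂ (Fin Nd))}
  {v : Fin ((Np + 1) / 2) → EuclideanSpace ℂ (Fin Nd)}
  {w : Fin (Np / 2) → EuclideanSpace ℂ (Fin Nd)} {c : Fin (Np / 2) → ℝ}

theorem inner_w_v (D : IsDecomposition Np V v w c) (m : Fin (Np / 2)) (n : Fin ((Np + 1) / 2)) :
    inner ℂ (w m) (v n) = if (m : ℕ) = (n : ℕ) then Complex.I * (c m : ℂ) else 0 := by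
  rw [← inner_conj_symm, D.inner_v_w]
  by_cases h : (m : ℕ) = n
  · simp [h]
  · rw [if_neg h, if_neg (Ne.symm h), map_zero]

theorem inner_v_extendZero (D : IsDecomposition Np V v w c) (m n : Fin ((Np + 1) / 2)) :
    inner ℂ (v m) (extendZero w n) =
      if m = n then -(Complex.I * ((extendZero c n : ℝ) : ℂ)) else 0 := by
  by_cases hn : (n : ℕ) < Np / 2
  · simp only [extendZero, dif_pos hn, D.inner_v_w, Fin.ext_iff]
  · simp [extendZero, dif_neg hn]

theorem inner_extendZero_v (D : IsDecomposition Np V v w c) (m n : Fin ((Np + 1) / 2)) :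
    inner ℂ (extendZero w m) (v n) =
      if m = n then Complex.I * ((extendZero c m : ℝ) : ℂ) else 0 := by
  rw [← inner_conj_symm, D.inner_v_extendZero]
  by_cases h : m = n
  · simp [h]
  · rw [if_neg h, if_neg (Ne.symm h), map_zero]

theorem inner_extendZero_w (D : IsDecomposition Np V v w c) (m : Fin ((Np + 1) / 2))
    (n : Fin (Np / 2)) :
    inner ℂ (extendZero w m) (w n) =
      if m = Fin.castLE (half_le_half Np) n then (1 : ℂ) else 0 := by
  by_cases hm : (m : ℕ) < Np / 2
  · simp only [extendZero, dif_pos hm, D.inner_w_w, Fin.ext_iff, Fin.val_castLE]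
  · have : m ≠ Fin.castLE (half_le_half Np) n := fun h => hm (h ▸ n.2)
    simp [extendZero, dif_neg hm, this]

theorem norm_v (D : IsDecomposition Np V v w c) (k : Fin ((Np + 1) / 2)) : ‖v k‖ = 1 := by
  rw [@norm_eq_sqrt_re_inner ℂ, D.inner_v_v, if_pos rfl]
  simp

theorem norm_w (D : IsDecomposition Np V v w c) (k : Fin (Np / 2)) : ‖w k‖ = 1 := by
  rw [@norm_eq_sqrt_re_inner ℂ, D.inner_w_w, if_pos rfl]
  simp

/-- For odd `Np` the unpaired `v` is given the partner `0` and the parameter `0`, so its weight is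
`1`. This is why `weighted_bessel` asks only for norms at most `1`. -/
theorem bessel (D : IsDecomposition Np V v w c) (x : EuclideanSpace ℂ (Fin Nd)) :
    ∑ i, weight c (splitIndex Np i) ^ 2 *
      ‖(inner ℂ (Sum.elim v w (splitIndex Np i)) x : ℂ)‖ ^ 2 ≤ ‖x‖ ^ 2 := by
  have h := weighted_bessel (v := v) (w := extendZero w) (c := extendZero c)
    (extendZero_nonneg D.c_nonneg) (fun k => (D.norm_v k).le) (fun k => ?_)
    (fun m n hmn => by rw [D.inner_v_v, if_neg hmn]) (fun m n hmn => ?_) D.inner_v_extendZero x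
  · refine le_trans (le_of_eq ?_) h
    rw [sum_splitIndex fun s => weight c s ^ 2 * ‖(inner ℂ (Sum.elim v w s) x : ℂ)‖ ^ 2]
    simp only [add_div, Finset.sum_add_distrib]
    congr 1
    · refine Finset.sum_congr rfl fun k _ => ?_
      have := (extendZero_nonneg D.c_nonneg) k
      simp only [weight, Sum.elim_inl]
      rw [div_pow, Real.sq_sqrt (by positivity)]
      ring
    · rw [sum_half _ 0 fun k hk => by simp [extendZero_of_le w k hk], mul_zero, add_zero]
      refine Finset.sum_congr rfl fun k _ => ?_
      have := D.c_nonneg k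
      simp only [weight, Sum.elim_inr, extendZero_castLE]
      rw [div_pow, Real.sq_sqrt (by positivity)]
      ring
  · unfold extendZero
    split_ifs
    · exact (D.norm_w _).le
    · simp
  · by_cases hn : (n : ℕ) < Np / 2
    · have := D.inner_extendZero_w m ⟨n, hn⟩
      rw [if_neg (fun h => hmn (h.trans (Fin.ext rfl)))] at this
      simpa [extendZero, hn] using this
    · simp [extendZero_of_le w n (not_lt.1 hn)]

theorem orthonormal (D : IsDecomposition Np V v w c) :
    Orthonormal ℝ fun i => Sum.elim v w (splitIndex Np i) := by
  refine Orthonormal.comp (v := Sum.elim v w) ?_ _ (splitIndex Np).injective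
  rw [orthonormal_iff_ite]
  rintro (m | m) (n | n)
  · rw [Sum.elim_inl, Sum.elim_inl, real_inner_eq_re, D.inner_v_v]
    split_ifs <;> simp_all
  · rw [Sum.elim_inl, Sum.elim_inr, real_inner_eq_re, D.inner_v_w]
    split_ifs <;> simp_all
  · rw [Sum.elim_inl, Sum.elim_inr, real_inner_eq_re, D.inner_w_v]
    split_ifs <;> simp_all
  · rw [Sum.elim_inr, Sum.elim_inr, real_inner_eq_re, D.inner_w_w]
    split_ifs <;> simp_all

theorem span_range (D : IsDecomposition Np V v w c) :
    Submodule.span ℝ (Set.range fun i => Sum.elim v w (splitIndex Np i)) = V := by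
  rw [← D.span_eq, ← Set.Sum.elim_range]
  congr 1
  exact (splitIndex Np).surjective.range_comp _

end IsDecomposition

/-- The scaling of the `k`-th column of the optimal matrix. -/
def columnScale {Np : ℕ} (P : ℝ) (c : Fin (Np / 2) → ℝ) (k : Fin ((Np + 1) / 2)) : ℝ :=
  √(P / normConst Np c) / (1 + extendZero c k) ^ (3 / 4 : ℝ)

theorem column_optimalMatrix {Nd Np : ℕ} (P : ℝ)
    (v : Fin ((Np + 1) / 2) → EuclideanSpace ℂ (Fin Nd))
    (w : Fin (Np / 2) → EuclideanSpace ℂ (Fin Nd)) (c : Fin (Np / 2) → ℝ)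
    (k : Fin ((Np + 1) / 2)) :
    column (optimalMatrix Np P v w c) k =
      (columnScale P c k : ℂ) • (v k + Complex.I • extendZero w k) := by
  ext i
  simp only [column, optimalMatrix, Matrix.of_apply, columnScale, PiLp.smul_apply, PiLp.add_apply,
    smul_eq_mul]
  by_cases hk : (k : ℕ) < Np / 2
  · simp only [extendZero, dif_pos hk]
    push_cast
    ring
  · simp [extendZero, dif_neg hk]

/-- This is where the exponent `3 / 4` matters: `scale ^ 2 * (1 + c)` becomes proportional to the
weight `1 / √(1 + c)`. Both the power of a column and the observed Gram entries are computed from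
it. -/
theorem columnScale_sq_mul {Np : ℕ} (hNp : 0 < Np) {P : ℝ} (hP : 0 < P) {c : Fin (Np / 2) → ℝ}
    (hc : ∀ k, 0 ≤ c k) (k : Fin ((Np + 1) / 2)) :
    columnScale P c k ^ 2 * (1 + extendZero c k) =
      P / normConst Np c * (1 / √(1 + extendZero c k)) := by
  have hC := normConst_pos hNp hc
  set x := 1 + extendZero c k with hx
  have hx0 : 0 < x := by linarith [extendZero_nonneg hc k]
  have h1 : (x ^ (3 / 4 : ℝ)) ^ 2 = x * √x := by
    rw [← Real.rpow_natCast, ← Real.rpow_mul hx0.le, Real.sqrt_eq_rpow]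
    nth_rw 2 [← Real.rpow_one x]
    rw [← Real.rpow_add hx0]
    norm_num
  rw [columnScale, ← hx, div_pow, Real.sq_sqrt (by positivity), h1]
  have : 0 < √x := Real.sqrt_pos.2 hx0
  field_simp

namespace IsDecomposition

variable {Nd Np : ℕ} {V : Submodule ℝ (EuclideanSpace ℂ (Fin Nd))}
  {v : Fin ((Np + 1) / 2) → EuclideanSpace ℂ (Fin Nd)}
  {w : Fin (Np / 2) → EuclideanSpace ℂ (Fin Nd)} {c : Fin (Np / 2) → ℝ}

theorem frobeniusSq_optimalMatrix (D : IsDecomposition Np V v w c) (hNp : 0 < Np) {P : ℝ}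
    (hP : 0 < P) : frobeniusSq (optimalMatrix Np P v w c) = P := by
  have hC := normConst_pos hNp D.c_nonneg
  have hcol : ∀ k, ‖column (optimalMatrix Np P v w c) k‖ ^ 2 =
      columnScale P c k ^ 2 * (1 + ‖extendZero w k‖ ^ 2 + 2 * extendZero c k) := fun k => by
    rw [column_optimalMatrix, norm_smul, mul_pow, Complex.norm_real, Real.norm_eq_abs, sq_abs,
      @norm_add_sq ℂ, D.norm_v, inner_smul_right, D.inner_v_extendZero, if_pos rfl, norm_smul]
    congr 1
    simp
    ring
  rw [frobeniusSq_eq_sum_column]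
  simp_rw [hcol]
  rw [sum_half _ (P / normConst Np c)]
  · simp only [extendZero_castLE, D.norm_w]
    have h : ∀ k, columnScale P c (Fin.castLE (half_le_half Np) k) ^ 2 *
        (1 + 1 ^ 2 + 2 * c k) = P / normConst Np c * (2 * (1 / √(1 + c k))) := fun k => by
      have := columnScale_sq_mul hNp hP D.c_nonneg (Fin.castLE (half_le_half Np) k)
      rw [extendZero_castLE] at this
      linarith
    simp_rw [h]
    rw [← Finset.mul_sum, ← Finset.mul_sum, mul_comm ((Np % 2 : ℕ) : ℝ), ← mul_add]
    exact div_mul_cancel₀ P hC.ne'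
  · intro k hk
    have := columnScale_sq_mul hNp hP D.c_nonneg k
    rw [extendZero_of_le c k hk] at this ⊢
    rw [extendZero_of_le w k hk]
    simpa using this

/-- Column `k` is a multiple of `v_k + j w_k`, whose product with `v_k` is `1 + c_k` and with `w_k`
is `-j (1 + c_k)`. Each pair thus occupies one complex coordinate, along perpendicular real
directions. -/
theorem observation_v (D : IsDecomposition Np V v w c) (P : ℝ) (l : Fin ((Np + 1) / 2)) :
    observation (optimalMatrix Np P v w c) (v l) =
      EuclideanSpace.single l ((columnScale P c l * (1 + extendZero c l) : ℝ) : ℂ) := by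
  ext k
  rw [observation_eq_inner, column_optimalMatrix, inner_smul_left, inner_add_left, inner_smul_left,
    D.inner_v_v, D.inner_extendZero_v, PiLp.single_apply]
  by_cases h : k = l
  · subst h
    simp only [if_true, Complex.conj_ofReal, Complex.conj_I]
    push_cast
    linear_combination (-(columnScale P c k : ℂ) * ((extendZero c k : ℝ) : ℂ)) * Complex.I_mul_I
  · simp [h]

theorem observation_w (D : IsDecomposition Np V v w c) (P : ℝ) (l : Fin (Np / 2)) :
    observation (optimalMatrix Np P v w c) (w l) =
      EuclideanSpace.single (Fin.castLE (half_le_half Np) l)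
        (-Complex.I * ((columnScale P c (Fin.castLE (half_le_half Np) l) * (1 + c l) : ℝ) : ℂ)) := by
  ext k
  rw [observation_eq_inner, column_optimalMatrix, inner_smul_left, inner_add_left, inner_smul_left,
    D.inner_v_w, D.inner_extendZero_w, PiLp.single_apply]
  by_cases h : k = Fin.castLE (half_le_half Np) l
  · subst h
    simp only [if_true, Complex.conj_ofReal, Complex.conj_I, Fin.val_castLE]
    push_cast
    ring
  · have : (k : ℕ) ≠ l := fun h' => h (Fin.ext h')
    simp [h, this]

/-- The diagonal entries are the inverses of the `s i = C / P * t i` used in the lower bound, which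
is the equality case of `trace_inv_ge`. -/
theorem observedGram_optimalMatrix (D : IsDecomposition Np V v w c) (hNp : 0 < Np) {P : ℝ}
    (hP : 0 < P) :
    observedGram (optimalMatrix Np P v w c) (fun i => Sum.elim v w (splitIndex Np i)) =
      Matrix.diagonal fun i => P / normConst Np c / weight c (splitIndex Np i) := by
  have hscale : ∀ k, (columnScale P c k * (1 + extendZero c k)) ^ 2 =
      P / normConst Np c * √(1 + extendZero c k) := fun k => by
    have h0 : 0 < 1 + extendZero c k := by linarith [(extendZero_nonneg D.c_nonneg) k]
    have := columnScale_sq_mul hNp hP D.c_nonneg k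
    have hs := Real.sq_sqrt h0.le
    have hs0 := Real.sqrt_pos.2 h0
    calc _ = columnScale P c k ^ 2 * (1 + extendZero c k) * (1 + extendZero c k) := by ring
      _ = P / normConst Np c * (1 / √(1 + extendZero c k)) * √(1 + extendZero c k) ^ 2 := by
          rw [this, hs]
      _ = _ := by field_simp
  have key : ∀ s t : Fin ((Np + 1) / 2) ⊕ Fin (Np / 2),
      inner ℝ (observation (optimalMatrix Np P v w c) (Sum.elim v w s))
        (observation (optimalMatrix Np P v w c) (Sum.elim v w t)) =
      if s = t then P / normConst Np c / weight c s else 0 := by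
    rintro (m | m) (n | n)
    · simp only [Sum.elim_inl, D.observation_v, real_inner_eq_re, EuclideanSpace.inner_single_left,
        PiLp.single_apply, Sum.inl.injEq, weight, Complex.conj_ofReal]
      split_ifs with h
      · subst h
        rw [← Complex.ofReal_mul, Complex.ofReal_re, ← sq, hscale, div_div_eq_mul_div, div_one]
      · simp
    · simp only [Sum.elim_inl, Sum.elim_inr, D.observation_v, D.observation_w, real_inner_eq_re,
        EuclideanSpace.inner_single_left, PiLp.single_apply, Complex.conj_ofReal]
      split_ifs <;> simp_all
    · simp only [Sum.elim_inl, Sum.elim_inr, D.observation_v, D.observation_w, real_inner_eq_re,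
        EuclideanSpace.inner_single_left, PiLp.single_apply, map_mul, map_neg,
        Complex.conj_ofReal, Complex.conj_I]
      split_ifs <;> simp_all
    · simp only [Sum.elim_inr, D.observation_w, real_inner_eq_re, EuclideanSpace.inner_single_left,
        PiLp.single_apply, Sum.inr.injEq, weight, map_mul, map_neg, Complex.conj_ofReal,
        Complex.conj_I, Fin.castLE_inj]
      split_ifs with h
      · subst h
        have := hscale (Fin.castLE (half_le_half Np) m)
        rw [extendZero_castLE] at this
        rw [div_div_eq_mul_div, div_one, ← this]
        simp
        ring
      · simp
  ext i j
  rw [observedGram, Matrix.of_apply, key, Matrix.diagonal_apply]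
  simp only [(splitIndex Np).injective.eq_iff]

end IsDecomposition

variable {Nd Np : ℕ} {h : EuclideanSpace ℝ (Fin Np) → EuclideanSpace ℂ (Fin Nd)}
  {θ : EuclideanSpace ℝ (Fin Np)} {σ : ℝ}
  {v : Fin ((Np + 1) / 2) → EuclideanSpace ℂ (Fin Nd)}
  {w : Fin (Np / 2) → EuclideanSpace ℂ (Fin Nd)} {c : Fin (Np / 2) → ℝ}

theorem crbMin_eq (Np : ℕ) (σ P : ℝ) (c : Fin (Np / 2) → ℝ) :
    crbMin Np σ P c = σ ^ 2 / 2 * (normConst Np c ^ 2 / P) := by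
  rw [crbMin, normConst]
  ring

theorem crbMin_le_crb (hh : DifferentiableAt ℝ h θ) (hσ : 0 < σ) {P : ℝ} (hP : 0 < P)
    (D : IsDecomposition Np (variationSpace h θ) v w c) {Nm : ℕ}
    {M : Matrix (Fin Nd) (Fin Nm) ℂ} (hM : frobeniusSq M = P) :
    ((crbMin Np σ P c : ℝ) : EReal) ≤ crb h σ θ M := by
  obtain ⟨h1, h2⟩ := crb_eq_of_orthonormal hh hσ M D.orthonormal D.span_range
  by_cases hu : IsUnit (observedGram M fun i => Sum.elim v w (splitIndex Np i)).det
  · rw [h1 hu, EReal.coe_le_coe_iff, crbMin_eq, ← sum_weight]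
    exact mul_le_mul_of_nonneg_left (le_trace_inv_observedGram hP hM D.bessel hu) (by positivity)
  · rw [h2 hu]
    exact le_top

theorem crb_optimalMatrix (hNp : 0 < Np) (hh : DifferentiableAt ℝ h θ) (hσ : 0 < σ) {P : ℝ}
    (hP : 0 < P) (D : IsDecomposition Np (variationSpace h θ) v w c) :
    crb h σ θ (optimalMatrix Np P v w c) = ((crbMin Np σ P c : ℝ) : EReal) := by
  have hC := normConst_pos hNp D.c_nonneg
  have hw := weight_pos D.c_nonneg
  have hu : IsUnit (observedGram (optimalMatrix Np P v w c)
      fun i => Sum.elim v w (splitIndex Np i)).det := by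
    rw [D.observedGram_optimalMatrix hNp hP, Matrix.det_diagonal, isUnit_iff_ne_zero]
    exact (Finset.prod_pos fun i _ => div_pos (div_pos hP hC) (hw _)).ne'
  rw [(crb_eq_of_orthonormal hh hσ _ D.orthonormal D.span_range).1 hu,
    D.observedGram_optimalMatrix hNp hP]
  have hinv : (Matrix.diagonal fun i => P / normConst Np c / weight c (splitIndex Np i))⁻¹ =
      Matrix.diagonal fun i => normConst Np c / P * weight c (splitIndex Np i) := by
    refine Matrix.inv_eq_right_inv ?_
    rw [Matrix.diagonal_mul_diagonal, ← Matrix.diagonal_one]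
    congr 1
    ext i
    have := (hw (splitIndex Np i)).ne'
    field_simp
  rw [hinv, Matrix.trace_diagonal, ← Finset.mul_sum, sum_weight, crbMin_eq]
  congr 1
  ring

end

end ChannelCRB

end

theorem theorem3 {Nd Np : ℕ} (hNp : 0 < Np)
    (h : EuclideanSpace ℝ (Fin Np) → EuclideanSpace ℂ (Fin Nd))
    (θ : EuclideanSpace ℝ (Fin Np)) (hh : DifferentiableAt ℝ h θ)
    (hdim : Module.finrank ℝ (ChannelCRB.variationSpace h θ) = Np)
    (σ P : ℝ) (hσ : 0 < σ) (hP : 0 < P) :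
    -- the decomposition that defines the scalars `c_k` exists
    (∃ v w c, ChannelCRB.IsDecomposition Np (ChannelCRB.variationSpace h θ) v w c) ∧
    -- the minimum, and the matrix that attains it, for every such decomposition
    (∀ v w c, ChannelCRB.IsDecomposition Np (ChannelCRB.variationSpace h θ) v w c →
      IsLeast
        {b : EReal | ∃ (Nm : ℕ) (M : Matrix (Fin Nd) (Fin Nm) ℂ),
          ChannelCRB.frobeniusSq M = P ∧ b = ChannelCRB.crb h σ θ M}
        ((ChannelCRB.crbMin Np σ P c : ℝ) : EReal) ∧
      ChannelCRB.frobeniusSq (ChannelCRB.optimalMatrix Np P v w c) = P ∧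
      ChannelCRB.crb h σ θ (ChannelCRB.optimalMatrix Np P v w c) =
        ((ChannelCRB.crbMin Np σ P c : ℝ) : EReal)) ∧
    -- `⌈Np/2⌉` columns is the minimal size of a matrix with finite bound
    (∀ (Nm : ℕ) (M : Matrix (Fin Nd) (Fin Nm) ℂ),
      ChannelCRB.crb h σ θ M ≠ ⊤ → (Np + 1) / 2 ≤ Nm) := by
  obtain hdec := ChannelCRB.exists_isDecomposition (ChannelCRB.variationSpace h θ) hdim
  refine ⟨hdec, fun v w c D => ⟨⟨?_, ?_⟩, D.frobeniusSq_optimalMatrix hNp hP,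
    ChannelCRB.crb_optimalMatrix hNp hh hσ hP D⟩, fun Nm M hM => ?_⟩
  · exact ⟨_, _, D.frobeniusSq_optimalMatrix hNp hP,
      (ChannelCRB.crb_optimalMatrix hNp hh hσ hP D).symm⟩
  · rintro _ ⟨Nm, M, hM, rfl⟩
    exact ChannelCRB.crbMin_le_crb hh hσ hP D hM
  · have := ChannelCRB.le_two_mul_columns_of_crb_ne_top hh hσ hM
    omega
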